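/- Let $n,k,s\ge 2$ be integers with $n\ge sk+1$. Let $KG(n,k)_{s\text{-stab}}$ be the $s$-stable Kneser graph: its vertices are the $k$-element subsets $S$ of $\{1,\dots,n\}$ such that $s\le |i-j|\le n-s$ for all distinct $i,j\in S$, and two vertices are adjacent if and only if they are disjoint as sets. Then $KG(n,k)_{s\text{-stab}}$ is vertex-transitive (that is, for any two vertices $S,T$ there is a graph automorphism mapping $S$ to $T$) if and only if $n=sk+1$. -/

import Mathlib

/-- The Kneser graph `KG(n,k)`: the vertices are the `k`-subsets of an `n`-element set (here
`Fin n = {0, …, n-1}`, i.e. `{1, …, n}` shifted by one), and distinct vertices are adjacent exactly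
when they are disjoint. (The condition `S ≠ T` only matters for `k = 0`.) -/
def kneserGraph (n k : ℕ) : SimpleGraph {S : Finset (Fin n) // S.card = k} where
  Adj S T := S ≠ T ∧ Disjoint S.1 T.1
  symm := ⟨fun _ _ h => ⟨h.1.symm, h.2.symm⟩⟩
  loopless := ⟨fun _ h => h.1 rfl⟩

/-- A subset `S` of the `n`-cycle is `s`-stable if `s ≤ |i - j| ≤ n - s` for all distinct
`i, j ∈ S`; the arithmetic takes place in `ℤ`. -/
def IsStableSet {n : ℕ} (s : ℕ) (S : Finset (Fin n)) : Prop :=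
  ∀ i ∈ S, ∀ j ∈ S, i ≠ j →
    (s : ℤ) ≤ |(i.val : ℤ) - (j.val : ℤ)| ∧ |(i.val : ℤ) - (j.val : ℤ)| ≤ (n : ℤ) - (s : ℤ)

/-- The `s`-stable Kneser graph: the subgraph of `KG(n,k)` induced by the `s`-stable
`k`-subsets. -/
def stableKneserGraph (n k s : ℕ) :
    SimpleGraph {S : {S : Finset (Fin n) // S.card = k} | IsStableSet s S.1} :=
  (kneserGraph n k).induce {S | IsStableSet s S.1}

/-- A graph is vertex-transitive if any vertex can be mapped to any other vertex by a graph
automorphism. -/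
def SimpleGraph.IsVertexTransitive {V : Type*} (G : SimpleGraph V) : Prop :=
  ∀ u v : V, ∃ φ : G ≃g G, φ u = v

/-! An automorphism is a permutation of the stable sets that preserves disjointness. Rotations of
the cycle are such permutations. If `n = s * k + 1`, the cyclic gaps of a stable set are all `s`
except for a single `s + 1`, so the rotations already act transitively.

If `n ≥ s * k + 2`, two vertices are told apart by invariants built from N(A) \ N(B) (`nbrDiff`),
whose size automorphisms preserve. When B arises from A by moving one point, this set is controlled
by the stable sets through one given point that avoid others (`starAvoid`). Such families are
compared by injections that shift some points of the cycle by one or two places; inequalities are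
made strict by exhibiting a set outside the image.

For `k ≥ 3` and `n < s * k + s`, the invariant is the least size of N(A) \ N(B) over B ≠ A. At the
tight set it is at least |`starAvoid n k s 0 (tightTail k s)`| (`card_starAvoid_tightTail_le`),
while at `shiftedTail` it is strictly smaller (`card_starAvoid_shiftedTail_lt`). For `k ≥ 3` and `n
≥ s * k + s`, the tight set has larger degree than `tightMoved` (`card_starAvoid_tightTail_lt`).

For `k = 2` the stable pairs are the edges of a circulant graph on the points. Sizes of N(e) \ N(f)
detect whether e and f lie in a common triangle, and how many edges join them when they are
disjoint. The edges {0, s} and {0, s + 1} lie in different numbers of triangles if `n ≥ 3 * s`;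
otherwise there are no triangles and they lie in different numbers of quadrangles. -/

/-! ### Stable sets of naturals and disjointness-preserving permutations. -/

/-- The `s`-stable `k`-subsets of the cycle `{0, …, n - 1}`, as sets of natural numbers. -/
def stab (n k s : ℕ) : Finset (Finset ℕ) :=
  {S ∈ (Finset.range n).powersetCard k |
    ∀ i ∈ S, ∀ j ∈ S, i < j → i + s ≤ j ∧ j + s ≤ i + n}

theorem mem_stab {n k s : ℕ} {S : Finset ℕ} : S ∈ stab n k s ↔
    (∀ x ∈ S, x < n) ∧ S.card = k ∧
      ∀ i ∈ S, ∀ j ∈ S, i < j → i + s ≤ j ∧ j + s ≤ i + n := by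
  simp only [stab, Finset.mem_filter, Finset.mem_powersetCard, Finset.subset_iff,
    Finset.mem_range, and_assoc]

theorem isStableSet_iff {n s : ℕ} {S : Finset (Fin n)} : IsStableSet s S ↔
    ∀ i ∈ S, ∀ j ∈ S, i.val < j.val → i.val + s ≤ j.val ∧ j.val + s ≤ i.val + n := by
  constructor
  · intro h i hi j hj hij
    obtain ⟨h1, h2⟩ := h i hi j hj (by rintro rfl; omega)
    rw [abs_of_neg (by omega)] at h1 h2
    omega
  · intro h i hi j hj hij
    rcases lt_or_gt_of_ne (Fin.val_ne_of_ne hij) with hlt | hlt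
    · have := h i hi j hj hlt
      rw [abs_of_neg (by omega)]
      omega
    · have := h j hj i hi hlt
      rw [abs_of_pos (by omega)]
      omega

theorem map_val_mem_stab {n k s : ℕ} {S : Finset (Fin n)} :
    S.map Fin.valEmbedding ∈ stab n k s ↔ S.card = k ∧ IsStableSet s S := by
  rw [mem_stab, isStableSet_iff]
  simp

/-- Forgetting that the elements are bounded by `n` identifies the vertices of the `s`-stable
Kneser graph with the members of `stab n k s`. -/
noncomputable def vertexEquiv (n k s : ℕ) :
    {S : {S : Finset (Fin n) // S.card = k} | IsStableSet s S.1} ≃ {U // U ∈ stab n k s} :=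
  Equiv.ofBijective (fun v => ⟨v.1.1.map Fin.valEmbedding, map_val_mem_stab.2 ⟨v.1.2, v.2⟩⟩) <| by
    constructor
    · intro v w h
      have h' := congrArg Subtype.val h
      exact Subtype.ext (Subtype.ext (Finset.map_injective _ h'))
    · rintro ⟨U, hU⟩
      have hm : (U.attachFin (mem_stab.1 hU).1).map Fin.valEmbedding = U := by
        simp
      have h := hU
      rw [← hm, map_val_mem_stab] at h
      exact ⟨⟨⟨_, h.1⟩, h.2⟩, Subtype.ext hm⟩

/-- For `k ≥ 1` a vertex is nonempty, hence not disjoint from itself, and the inequality in the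
adjacency relation is automatic. -/
theorem adj_iff_disjoint_vertexEquiv {n k s : ℕ} (hk : 1 ≤ k)
    (v w : {S : {S : Finset (Fin n) // S.card = k} | IsStableSet s S.1}) :
    (stableKneserGraph n k s).Adj v w ↔
      Disjoint (vertexEquiv n k s v).1 (vertexEquiv n k s w).1 := by
  have h1 : (stableKneserGraph n k s).Adj v w ↔ v.1 ≠ w.1 ∧ Disjoint v.1.1 w.1.1 := Iff.rfl
  have h2 : Disjoint (vertexEquiv n k s v).1 (vertexEquiv n k s w).1 ↔
      Disjoint v.1.1 w.1.1 := by
    exact Finset.disjoint_map _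
  rw [h1, h2, and_iff_right_iff_imp]
  intro hd he
  rw [he, disjoint_self, Finset.bot_eq_empty] at hd
  have := w.1.2
  rw [hd, Finset.card_empty] at this
  omega

theorem isVertexTransitive_iff {n k s : ℕ} (hk : 1 ≤ k) :
    (stableKneserGraph n k s).IsVertexTransitive ↔
      ∀ S T : {U // U ∈ stab n k s}, ∃ g : Equiv.Perm {U // U ∈ stab n k s},
        g S = T ∧ ∀ A B, Disjoint (g A).1 (g B).1 ↔ Disjoint A.1 B.1 := by
  constructor
  · intro h S T
    obtain ⟨φ, hφ⟩ := h ((vertexEquiv n k s).symm S) ((vertexEquiv n k s).symm T)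
    refine ⟨((vertexEquiv n k s).symm.trans φ.toEquiv).trans (vertexEquiv n k s), ?_, ?_⟩
    · simp [hφ]
    · intro A B
      simp only [Equiv.trans_apply, RelIso.coe_fn_toEquiv]
      rw [← adj_iff_disjoint_vertexEquiv hk, φ.map_adj_iff, adj_iff_disjoint_vertexEquiv hk]
      simp
  · intro h u v
    obtain ⟨g, hg, hd⟩ := h (vertexEquiv n k s u) (vertexEquiv n k s v)
    refine ⟨⟨((vertexEquiv n k s).trans g).trans (vertexEquiv n k s).symm, ?_⟩, ?_⟩
    · intro A B
      rw [adj_iff_disjoint_vertexEquiv hk, adj_iff_disjoint_vertexEquiv hk]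
      simp [hd]
    · simp [hg]

/-! ### Neighbourhood differences as invariants. -/

/-- The stable sets which are disjoint from `A` and meet `B`. -/
def nbrDiff (n k s : ℕ) (A B : Finset ℕ) : Finset (Finset ℕ) :=
  {U ∈ stab n k s | Disjoint U A ∧ ¬ Disjoint U B}

theorem mem_nbrDiff {n k s : ℕ} {A B U : Finset ℕ} :
    U ∈ nbrDiff n k s A B ↔ U ∈ stab n k s ∧ Disjoint U A ∧ ¬ Disjoint U B := by
  simp [nbrDiff]

/-- The stable sets which contain `w` and are disjoint from `X`. -/
def starAvoid (n k s w : ℕ) (X : Finset ℕ) : Finset (Finset ℕ) :=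
  {U ∈ stab n k s | w ∈ U ∧ Disjoint U X}

theorem mem_starAvoid {n k s w : ℕ} {X U : Finset ℕ} :
    U ∈ starAvoid n k s w X ↔ U ∈ stab n k s ∧ w ∈ U ∧ ∀ x ∈ U, x ∉ X := by
  simp [starAvoid, Finset.disjoint_left]

/-- The source of every invariant below: a property expressed through disjointness is carried along
by `g`, so its count is preserved. -/
theorem card_filter_stab_eq {n k s : ℕ} (g : Equiv.Perm {U // U ∈ stab n k s})
    (P Q : Finset ℕ → Prop) [DecidablePred P] [DecidablePred Q]
    (h : ∀ A, P A.1 ↔ Q (g A).1) :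
    ((stab n k s).filter P).card = ((stab n k s).filter Q).card := by
  refine Finset.card_bij' (fun U hU => (g ⟨U, (Finset.mem_filter.1 hU).1⟩).1)
    (fun U hU => (g.symm ⟨U, (Finset.mem_filter.1 hU).1⟩).1) ?_ ?_ ?_ ?_
  · intro U hU
    exact Finset.mem_filter.2 ⟨(g _).2, (h _).1 (Finset.mem_filter.1 hU).2⟩
  · intro U hU
    refine Finset.mem_filter.2 ⟨(g.symm _).2, (h _).2 ?_⟩
    simpa using (Finset.mem_filter.1 hU).2
  · intro U hU
    simp
  · intro U hU
    simp

theorem card_nbrDiff_map {n k s : ℕ} (g : Equiv.Perm {U // U ∈ stab n k s})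
    (hg : ∀ A B, Disjoint (g A).1 (g B).1 ↔ Disjoint A.1 B.1) (A B : {U // U ∈ stab n k s}) :
    (nbrDiff n k s (g A).1 (g B).1).card = (nbrDiff n k s A.1 B.1).card :=
  (card_filter_stab_eq g _ _ fun U => by rw [hg, hg]).symm

/-! ### Moving points of stable sets, and packing bounds. -/

/-- The alternative in `hsep` allows maps that wrap around the cycle and so reverse the order of
some pairs. Separation by `s ≥ 1` also makes `f` injective on `U`, which keeps the cardinality. -/
theorem image_mem_stab {n k s : ℕ} (hs : 1 ≤ s) {U : Finset ℕ} (hU : U.card = k) (f : ℕ → ℕ)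
    (hf : ∀ x ∈ U, f x < n)
    (hsep : ∀ x ∈ U, ∀ y ∈ U, x < y → (f x + s ≤ f y ∧ f y + s ≤ f x + n) ∨
      (f y + s ≤ f x ∧ f x + s ≤ f y + n)) :
    U.image f ∈ stab n k s := by
  rw [mem_stab]
  refine ⟨by simpa using hf, ?_, ?_⟩
  · rw [Finset.card_image_of_injOn, hU]
    intro x hx y hy hxy
    rcases lt_trichotomy x y with h | h | h
    · have := hsep x hx y hy h; omega
    · exact h
    · have := hsep y hy x hx h; omega
  · simp only [Finset.mem_image]
    rintro _ ⟨x, hx, rfl⟩ _ ⟨y, hy, rfl⟩ hlt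
    rcases lt_trichotomy x y with h | h | h
    · have := hsep x hx y hy h; omega
    · subst h; omega
    · have := hsep y hy x hx h; omega

theorem image_injOn_of_injOn {f : ℕ → ℕ} {D : Set ℕ} (hf : Set.InjOn f D)
    (F : Finset (Finset ℕ)) (hF : ∀ U ∈ F, ∀ x ∈ U, x ∈ D) :
    Set.InjOn (fun U : Finset ℕ => U.image f) F := by
  have key : ∀ U ∈ F, ∀ V ∈ F, U.image f = V.image f → U ⊆ V := by
    intro U hU V hV h x hx
    have hm : f x ∈ V.image f := h ▸ Finset.mem_image_of_mem f hx
    obtain ⟨y, hy, hxy⟩ := Finset.mem_image.1 hm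
    rwa [← hf (hF V hV y hy) (hF U hU x hx) hxy]
  intro U hU V hV h
  exact (key U hU V hV h).antisymm (key V hV U hU h.symm)

/-- Members of a stable set containing `0` lie in `[s, n - s]`. -/
theorem bounds_of_zero_mem {n k s : ℕ} {U : Finset ℕ} (hU : U ∈ stab n k s) (h0 : 0 ∈ U)
    {x : ℕ} (hx : x ∈ U) (hx0 : x ≠ 0) : s ≤ x ∧ x + s ≤ n := by
  have := (mem_stab.1 hU).2.2 0 h0 x hx (by omega)
  omega

/-- Division by `s`, measured from `a`, sends separated points to distinct block indices below `(b -
a) / s`. -/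
theorem card_mul_le_of_separated {F : Finset ℕ} {a b s : ℕ} (hs : 1 ≤ s)
    (hF : ∀ x ∈ F, a ≤ x ∧ x + s ≤ b) (hsep : ∀ x ∈ F, ∀ y ∈ F, x < y → x + s ≤ y) :
    F.card * s ≤ b - a := by
  have hdiv : ∀ u v, u + s ≤ v → u / s < v / s := by
    intro u v h
    calc u / s < u / s + 1 := Nat.lt_succ_self _
      _ = (u + s) / s := (Nat.add_div_right u hs).symm
      _ ≤ v / s := Nat.div_le_div_right h
  have h1 : F.card ≤ (Finset.range ((b - a) / s)).card := by
    refine Finset.card_le_card_of_injOn (fun x => (x - a) / s) ?_ ?_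
    · intro x hx
      have := hF x hx
      simpa using hdiv (x - a) (b - a) (by omega)
    · intro x hx y hy hxy
      have hxa := hF x hx
      have hya := hF y hy
      simp only at hxy
      rcases lt_trichotomy x y with h | h | h
      · have h1 := hsep x hx y hy h
        have := hdiv (x - a) (y - a) (by omega)
        omega
      · exact h
      · have h1 := hsep y hy x hx h
        have := hdiv (y - a) (x - a) (by omega)
        omega
  rw [Finset.card_range] at h1
  exact (Nat.mul_le_mul_right s h1).trans (Nat.div_mul_le_self _ _)

/-- Each member of a stable set containing `0` has one of the forms `c * s + q`, `q ≤ n - s * k`. -/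
theorem exists_window {n k s r : ℕ} (hs : 1 ≤ s) (hk : 1 ≤ k) (hn : n = s * k + r) {U : Finset ℕ}
    (hU : U ∈ stab n k s) (h0 : 0 ∈ U) {x : ℕ} (hx : x ∈ U) :
    ∃ c, c * s ≤ x ∧ x ≤ c * s + r := by
  obtain ⟨hlt, hcard, hsep⟩ := mem_stab.1 hU
  have hsn : s ≤ n := by nlinarith
  have hle : ∀ y ∈ U, y + s ≤ n := by
    intro y hy
    rcases Nat.eq_zero_or_pos y with h | h
    · omega
    · exact (bounds_of_zero_mem hU h0 hy (by omega)).2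
  -- Take c to be the number of members below `x`. Packing these into [0, x) and the other `k - c`
  -- into [x, n) bounds `x` from both sides.
  have h1 := card_mul_le_of_separated (F := U.filter (· < x)) (a := 0) (b := x) hs
    (by
      intro y hy
      rw [Finset.mem_filter] at hy
      have := hsep y hy.1 x hx hy.2
      omega)
    (fun y hy z hz h => (hsep y (Finset.mem_filter.1 hy).1 z (Finset.mem_filter.1 hz).1 h).1)
  have h2 := card_mul_le_of_separated (F := U.filter (¬ · < x)) (a := x) (b := n) hs
    (by
      intro y hy
      rw [Finset.mem_filter] at hy
      have := hle y hy.1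
      omega)
    (fun y hy z hz h => (hsep y (Finset.mem_filter.1 hy).1 z (Finset.mem_filter.1 hz).1 h).1)
  have h3 := Finset.card_filter_add_card_filter_not (s := U) (· < x)
  have hxn := hlt x hx
  refine ⟨(U.filter (· < x)).card, by omega, ?_⟩
  have h4 : (U.filter (· < x)).card * s + (U.filter (¬ · < x)).card * s = s * k := by
    rw [← add_mul, h3, hcard, mul_comm]
  omega

/-! ### Rotations and the transitive case `n = s * k + 1`. -/

/-- Rotation of the cycle `{0, …, n - 1}` by `w`. -/
def rot (n w x : ℕ) : ℕ := if x + w < n then x + w else x + w - n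

theorem rot_injOn {n w : ℕ} : Set.InjOn (rot n w) {x | x < n} := by
  intro x hx y hy h
  simp only [Set.mem_ofPred_eq] at hx hy
  unfold rot at h
  split_ifs at h <;> omega

theorem image_rot_mem_stab {n k s w : ℕ} (hs : 1 ≤ s) (hw : w ≤ n) {U : Finset ℕ}
    (hU : U ∈ stab n k s) : U.image (rot n w) ∈ stab n k s := by
  obtain ⟨hlt, hcard, hsep⟩ := mem_stab.1 hU
  refine image_mem_stab hs hcard _ ?_ ?_
  · intro x hx
    have := hlt x hx
    unfold rot
    split_ifs <;> omega
  · intro x hx y hy hxy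
    have h := hsep x hx y hy hxy
    have := hlt x hx
    have := hlt y hy
    unfold rot
    split_ifs <;> omega

theorem image_rot_image_rot {n k s w : ℕ} (hw : w ≤ n) {U : Finset ℕ}
    (hU : U ∈ stab n k s) : (U.image (rot n w)).image (rot n (n - w)) = U := by
  rw [Finset.image_image]
  conv_rhs => rw [← Finset.image_id (s := U)]
  refine Finset.image_congr fun x hx => ?_
  have := (mem_stab.1 hU).1 x hx
  simp only [Function.comp, rot, id]
  split_ifs <;> omega

/-- The stable set `{0, s, …, (k - 1) * s}`. -/
def tight (k s : ℕ) : Finset ℕ := (Finset.range k).image (· * s)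

theorem mem_tight {k s x : ℕ} : x ∈ tight k s ↔ ∃ j < k, j * s = x := by
  simp [tight]

theorem tight_mem_stab {n k s : ℕ} (hs : 1 ≤ s) (hn : s * k ≤ n) : tight k s ∈ stab n k s := by
  have hb : ∀ j < k, j * s + s ≤ n := by
    intro j hj
    have : (j + 1) * s ≤ k * s := Nat.mul_le_mul_right s hj
    linarith [add_mul j 1 s, mul_comm k s]
  refine image_mem_stab hs (Finset.card_range k) _ ?_ ?_
  · intro j hj
    have := hb j (Finset.mem_range.1 hj)
    omega
  · intro i hi j hj hij
    have h1 := hb j (Finset.mem_range.1 hj)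
    have h2 : (i + 1) * s ≤ j * s := Nat.mul_le_mul_right s hij
    rw [add_mul, one_mul] at h2
    left
    omega

/-- If `n = s * k + 1` then every stable set is a rotation of the tight one. -/
theorem exists_image_rot_eq_tight {n k s : ℕ} (hs : 1 ≤ s) (hn : n = s * k + 1) {S : Finset ℕ}
    (hS : S ∈ stab n k s) : ∃ w ≤ n, S.image (rot n w) = tight k s := by
  -- The `k` arcs of length `s` starting at members of `S` cover at most `s * k < n` points, so some
  -- `p` is uncovered. Rotating `p` to the last point `n - 1` leaves all arcs inside [0, s * k).
  obtain ⟨p, hpn, hp⟩ : ∃ p < n, ∀ x ∈ S, ∀ t < s, (x + t) % n ≠ p := by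
    by_contra! h
    have h1 : Finset.range n ⊆ (S ×ˢ Finset.range s).image fun q => (q.1 + q.2) % n := by
      intro p hp
      obtain ⟨x, hx, t, ht, e⟩ := h p (Finset.mem_range.1 hp)
      exact Finset.mem_image.2 ⟨(x, t), by simp [hx, ht], e⟩
    have h2 := (Finset.card_le_card h1).trans Finset.card_image_le
    rw [Finset.card_product, Finset.card_range, Finset.card_range, (mem_stab.1 hS).2.1,
      mul_comm] at h2
    omega
  refine ⟨n - (p + 1), by omega, ?_⟩
  have hR := image_rot_mem_stab (w := n - (p + 1)) hs (by omega) hS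
  have hend : ∀ y ∈ S.image (rot n (n - (p + 1))), y + s ≤ s * k := by
    simp only [Finset.mem_image]
    rintro _ ⟨x, hx, rfl⟩
    have hxn := (mem_stab.1 hS).1 x hx
    by_contra hcon
    by_cases hxp : x ≤ p
    · have hr : rot n (n - (p + 1)) x = x + (n - (p + 1)) := by
        unfold rot; split_ifs <;> omega
      refine hp x hx (p - x) (by omega) ?_
      rw [show x + (p - x) = p by omega, Nat.mod_eq_of_lt hpn]
    · have hr : rot n (n - (p + 1)) x = x - (p + 1) := by
        unfold rot; split_ifs <;> omega
      refine hp x hx (p + n - x) (by omega) ?_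
      rw [show x + (p + n - x) = p + n by omega, Nat.add_mod_right, Nat.mod_eq_of_lt hpn]
  set R := S.image (rot n (n - (p + 1))) with hRdef
  obtain ⟨hlt, hcard, hsep⟩ := mem_stab.1 hR
  refine Finset.eq_of_subset_of_card_le ?_ ?_
  · intro x hx
    -- With no slack left, packing on the two sides of `x` forces `x` to be exactly `s` times the
    -- number of members below it.
    have h1 := card_mul_le_of_separated (F := R.filter (· < x)) (a := 0) (b := x) hs
      (by
        intro y hy
        rw [Finset.mem_filter] at hy
        have := hsep y hy.1 x hx hy.2
        omega)
      (fun y hy z hz h => (hsep y (Finset.mem_filter.1 hy).1 z (Finset.mem_filter.1 hz).1 h).1)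
    have h2 := card_mul_le_of_separated (F := R.filter (¬ · < x)) (a := x) (b := s * k) hs
      (by
        intro y hy
        rw [Finset.mem_filter] at hy
        have := hend y hy.1
        omega)
      (fun y hy z hz h => (hsep y (Finset.mem_filter.1 hy).1 z (Finset.mem_filter.1 hz).1 h).1)
    have h3 := Finset.card_filter_add_card_filter_not (s := R) (· < x)
    have h4 : (R.filter (· < x)).card * s + (R.filter (¬ · < x)).card * s = s * k := by
      rw [← add_mul, h3, hcard, mul_comm]
    have h5 : 0 < (R.filter (¬ · < x)).card :=
      Finset.card_pos.2 ⟨x, Finset.mem_filter.2 ⟨hx, lt_irrefl x⟩⟩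
    have := hend x hx
    exact mem_tight.2 ⟨(R.filter (· < x)).card, by omega, by omega⟩
  · rw [hcard, (mem_stab.1 (tight_mem_stab hs (show s * k ≤ n by omega))).2.1]

/-- Rotation as a permutation of the stable sets. -/
def rotPerm {n k s : ℕ} (hs : 1 ≤ s) (w : ℕ) (hw : w ≤ n) :
    Equiv.Perm {U // U ∈ stab n k s} where
  toFun U := ⟨U.1.image (rot n w), image_rot_mem_stab hs hw U.2⟩
  invFun U := ⟨U.1.image (rot n (n - w)), image_rot_mem_stab hs (Nat.sub_le n w) U.2⟩
  left_inv U := Subtype.ext (image_rot_image_rot hw U.2)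
  right_inv U := Subtype.ext <| by
    have := image_rot_image_rot (Nat.sub_le n w) U.2
    rwa [Nat.sub_sub_self hw] at this

theorem disjoint_rotPerm {n k s : ℕ} (hs : 1 ≤ s) (w : ℕ) (hw : w ≤ n)
    (A B : {U // U ∈ stab n k s}) :
    Disjoint (rotPerm hs w hw A).1 (rotPerm hs w hw B).1 ↔ Disjoint A.1 B.1 := by
  simp only [rotPerm, Equiv.coe_fn_mk, Finset.disjoint_left, Finset.mem_image]
  constructor
  · intro h x hxA hxB
    exact h ⟨x, hxA, rfl⟩ ⟨x, hxB, rfl⟩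
  · rintro h _ ⟨x, hxA, rfl⟩ ⟨y, hyB, hxy⟩
    have := rot_injOn ((mem_stab.1 B.2).1 y hyB) ((mem_stab.1 A.2).1 x hxA) hxy
    exact h hxA (this ▸ hyB)

theorem isVertexTransitive_of_eq {n k s : ℕ} (hs : 1 ≤ s) (hk : 1 ≤ k) (hn : n = s * k + 1) :
    (stableKneserGraph n k s).IsVertexTransitive := by
  rw [isVertexTransitive_iff hk]
  intro S T
  obtain ⟨a, ha, hSa⟩ := exists_image_rot_eq_tight hs hn S.2
  obtain ⟨b, hb, hTb⟩ := exists_image_rot_eq_tight hs hn T.2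
  refine ⟨(rotPerm hs a ha).trans (rotPerm hs b hb).symm, ?_, ?_⟩
  · rw [Equiv.trans_apply, Equiv.symm_apply_eq]
    exact Subtype.ext (hSa.trans hTb.symm)
  · intro A B
    rw [Equiv.trans_apply, Equiv.trans_apply, ← disjoint_rotPerm hs b hb]
    simp [disjoint_rotPerm]

/-! ### The case `k ≥ 3`, `s * k + 2 ≤ n < s * k + s`: smallest neighbourhood differences. -/

/-- Comparing families of stable sets along an injection of the points. -/
theorem card_le_card_of_image {F G : Finset (Finset ℕ)} (f : ℕ → ℕ) (D : Set ℕ)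
    (hf : Set.InjOn f D) (hF : ∀ U ∈ F, ∀ x ∈ U, x ∈ D) (hG : ∀ U ∈ F, U.image f ∈ G) :
    F.card ≤ G.card :=
  Finset.card_le_card_of_injOn _ hG (image_injOn_of_injOn hf F hF)

theorem card_lt_card_of_image {F G : Finset (Finset ℕ)} (f : ℕ → ℕ) (D : Set ℕ)
    (hf : Set.InjOn f D) (hF : ∀ U ∈ F, ∀ x ∈ U, x ∈ D) (hG : ∀ U ∈ F, U.image f ∈ G)
    {V : Finset ℕ} (hV : V ∈ G) (hVF : ∀ U ∈ F, U.image f ≠ V) : F.card < G.card := by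
  refine lt_of_le_of_lt (b := (G.erase V).card) ?_ (Finset.card_erase_lt_of_mem hV)
  exact card_le_card_of_image f D hf hF fun U hU => Finset.mem_erase.2 ⟨hVF U hU, hG U hU⟩

/-- The points `s, 2 * s, …, (k - 1) * s`. -/
def tightTail (k s : ℕ) : Finset ℕ := (Finset.Ico 1 k).image (· * s)

theorem mem_tightTail {k s x : ℕ} : x ∈ tightTail k s ↔ ∃ j, (1 ≤ j ∧ j < k) ∧ j * s = x := by
  simp [tightTail]

theorem mul_add_le_mul {i j : ℕ} (s : ℕ) (h : i < j) : i * s + s ≤ j * s := by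
  have := Nat.mul_le_mul_right s (Nat.succ_le_of_lt h)
  rwa [Nat.succ_mul] at this

/-- A stable set shifted along from the tight one. -/
def shiftedTail (n k s : ℕ) : Finset ℕ :=
  (Finset.range k).image fun j =>
    if j = 0 then s else if j + 1 = k then n - 1 else (j + 1) * s + 1

theorem mem_shiftedTail {n k s x : ℕ} (hk : 3 ≤ k) : x ∈ shiftedTail n k s ↔
    x = s ∨ x = n - 1 ∨ ∃ j, (2 ≤ j ∧ j < k) ∧ j * s + 1 = x := by
  simp only [shiftedTail, Finset.mem_image, Finset.mem_range]
  constructor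
  · rintro ⟨j, hj, rfl⟩
    split_ifs with h1 h2
    · exact Or.inl rfl
    · exact Or.inr (Or.inl rfl)
    · exact Or.inr (Or.inr ⟨j + 1, by omega, rfl⟩)
  · rintro (rfl | rfl | ⟨j, hj, rfl⟩)
    · exact ⟨0, by omega, by simp⟩
    · exact ⟨k - 1, by omega, by rw [if_neg (by omega), if_pos (by omega)]⟩
    · exact ⟨j - 1, by omega, by
        rw [if_neg (by omega), if_neg (by omega), show j - 1 + 1 = j by omega]⟩

theorem shiftedTail_mem_stab {n k s : ℕ} (hs : 2 ≤ s) (hk : 3 ≤ k) (hn : s * k + 2 ≤ n) :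
    shiftedTail n k s ∈ stab n k s := by
  have hks : s * k = k * s := mul_comm _ _
  have h2s : 2 * s ≤ k * s := Nat.mul_le_mul_right s (by omega)
  have hb : ∀ j, j + 1 < k → (j + 1) * s + s ≤ k * s := fun j hj => mul_add_le_mul s hj
  refine image_mem_stab (by omega) (Finset.card_range k) _ ?_ ?_
  · intro j hj
    have := Finset.mem_range.1 hj
    have := hb j
    split_ifs <;> omega
  · intro i hi j hj hij
    left
    have hj' := Finset.mem_range.1 hj
    have h1 := hb j
    have h2 := hb i
    have h3 := mul_add_le_mul s (show i + 1 < j + 1 by omega)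
    have h4 : 0 < i → 1 * s + s ≤ (i + 1) * s := fun h => mul_add_le_mul s (by omega)
    have h5 : 1 * s + s ≤ (j + 1) * s := mul_add_le_mul s (by omega)
    split_ifs <;> omega

/-- The stable set obtained from `shiftedTail` by moving `n - 1` to `0`. -/
def shiftedHead (k s : ℕ) : Finset ℕ :=
  (Finset.range k).image fun j => if j = 0 then 0 else if j = 1 then s else j * s + 1

theorem mem_shiftedHead {k s x : ℕ} (hk : 3 ≤ k) : x ∈ shiftedHead k s ↔
    x = 0 ∨ x = s ∨ ∃ j, (2 ≤ j ∧ j < k) ∧ j * s + 1 = x := by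
  simp only [shiftedHead, Finset.mem_image, Finset.mem_range]
  constructor
  · rintro ⟨j, hj, rfl⟩
    split_ifs with h1 h2
    · exact Or.inl rfl
    · exact Or.inr (Or.inl rfl)
    · exact Or.inr (Or.inr ⟨j, by omega, rfl⟩)
  · rintro (rfl | rfl | ⟨j, hj, rfl⟩)
    · exact ⟨0, by omega, by simp⟩
    · exact ⟨1, by omega, by simp⟩
    · exact ⟨j, by omega, by rw [if_neg (by omega), if_neg (by omega)]⟩

theorem shiftedHead_mem_stab {n k s : ℕ} (hs : 2 ≤ s) (hn : s * k + 2 ≤ n) :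
    shiftedHead k s ∈ stab n k s := by
  have hks : s * k = k * s := mul_comm _ _
  have hb : ∀ j, j < k → j * s + s ≤ k * s := fun j hj => mul_add_le_mul s hj
  refine image_mem_stab (by omega) (Finset.card_range k) _ ?_ ?_
  · intro j hj
    have := hb j (Finset.mem_range.1 hj)
    split_ifs <;> omega
  · intro i hi j hj hij
    left
    have h1 := hb j (Finset.mem_range.1 hj)
    have h3 := mul_add_le_mul s hij
    have h4 : 1 < i → 1 * s + s ≤ i * s := fun h => mul_add_le_mul s (by omega)
    have h5 : 1 < j → 1 * s + s ≤ j * s := fun h => mul_add_le_mul s (by omega)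
    have h6 : i = 0 → i * s = 0 := fun h => by simp [h]
    split_ifs <;> omega

open Classical in
-- Moving each point `j * s` with `2 ≤ j < k` up by one vacates it, and its target `j * s + 1` is
-- free because `shiftedTail` is avoided. The remaining forbidden point `s` is avoided from the
-- start.
theorem card_starAvoid_shiftedTail_lt {n k s : ℕ} (hs : 2 ≤ s) (hk : 3 ≤ k)
    (hn : s * k + 2 ≤ n) (hns : n < s * k + s) :
    (starAvoid n k s 0 (shiftedTail n k s)).card < (starAvoid n k s 0 (tightTail k s)).card := by
  have hks : s * k = k * s := mul_comm _ _
  set P : ℕ → Prop := fun x => ∃ j, (2 ≤ j ∧ j < k) ∧ j * s = x with hP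
  have hPks : ∀ x, P x → x + s ≤ k * s ∧ 2 * s ≤ x := by
    rintro _ ⟨j, hj, rfl⟩
    exact ⟨mul_add_le_mul s hj.2, Nat.mul_le_mul_right s hj.1⟩
  set f : ℕ → ℕ := fun x => if P x then x + 1 else x with hf
  have hfP : ∀ x, P x → f x = x + 1 := fun x hx => if_pos hx
  have hfN : ∀ x, ¬ P x → f x = x := fun x hx => if_neg hx
  have hP1 : ∀ i j, i * s = j * s + 1 → False := by
    intro i j h
    rcases lt_trichotomy i j with h' | h' | h'
    · have := mul_add_le_mul s h'; omega
    · subst h'; omega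
    · have := mul_add_le_mul s h'; omega
  have hD : ∀ U ∈ starAvoid n k s 0 (shiftedTail n k s), ∀ x ∈ U, x ∉ shiftedTail n k s :=
    fun U hU x hx => (mem_starAvoid.1 hU).2.2 x hx
  -- The set {0, s + 1, 2s + 1, …} is missed: a preimage would contain the unmoved point s + 1
  -- together with 2s, which are only s - 1 apart.
  refine card_lt_card_of_image f {x | x ∉ shiftedTail n k s} ?_ hD ?_
    (V := (Finset.range k).image fun j => if j = 0 then 0 else j * s + 1) ?_ ?_
  · have key : ∀ x y, y ∉ shiftedTail n k s → P x → ¬ P y → x + 1 ≠ y := by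
      rintro x y hy ⟨j, hj, rfl⟩ - rfl
      exact hy ((mem_shiftedTail hk).2 (Or.inr (Or.inr ⟨j, hj, rfl⟩)))
    intro x hx y hy hxy
    have h1 := key x y hy
    have h2 := key y x hx
    simp only [hf] at hxy
    split_ifs at hxy with h3 h4 h4
    · omega
    · exact absurd hxy (h1 h3 h4)
    · exact absurd hxy.symm (h2 h4 h3)
    · exact hxy
  · intro U hU
    obtain ⟨hUs, h0, hav⟩ := mem_starAvoid.1 hU
    obtain ⟨hlt, hcard, hsep⟩ := mem_stab.1 hUs
    rw [mem_starAvoid]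
    refine ⟨image_mem_stab (by omega) hcard f ?_ ?_, ?_, ?_⟩
    · intro x hx
      have := hlt x hx
      by_cases h : P x
      · have := hPks x h
        rw [hfP x h]; omega
      · rwa [hfN x h]
    · intro x hx y hy hxy
      left
      have h1 := hsep x hx y hy hxy
      have hb := bounds_of_zero_mem hUs h0 hy (by omega)
      -- The only danger is a moved `x` with an unmoved `y` at distance exactly `s`. Such a `y`
      -- would be the next multiple of `s`, hence moved too, unless it is `k * s`; that is excluded
      -- by `y + s ≤ n < s * k + s`.
      have h2 : P x → ¬ P y → x + s ≠ y := by
        rintro ⟨j, hj, rfl⟩ hPy rfl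
        rcases Nat.lt_or_ge (j + 1) k with h | h
        · exact hPy ⟨j + 1, by omega, by ring⟩
        · have hjk : j + 1 = k := by omega
          have h3 : j * s + s = k * s := by rw [← hjk]; ring
          omega
      by_cases h4 : P x <;> by_cases h5 : P y
      · rw [hfP x h4, hfP y h5]; omega
      · have := h2 h4 h5
        rw [hfP x h4, hfN y h5]; omega
      · have := hPks y h5
        rw [hfN x h4, hfP y h5]; omega
      · rw [hfN x h4, hfN y h5]; omega
    · refine Finset.mem_image.2 ⟨0, h0, hfN 0 fun h => ?_⟩
      have := hPks 0 h
      omega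
    · simp only [Finset.mem_image, mem_tightTail]
      rintro _ ⟨x, hx, rfl⟩ ⟨j, hj, hjx⟩
      by_cases h : P x
      · rw [hfP x h] at hjx
        obtain ⟨i, hi, rfl⟩ := h
        exact hP1 _ _ hjx
      · rw [hfN x h] at hjx
        rcases Nat.lt_or_ge j 2 with h2 | h2
        · refine hav x hx ((mem_shiftedTail hk).2 (Or.inl ?_))
          rw [← hjx, show j = 1 by omega, one_mul]
        · exact h ⟨j, ⟨h2, hj.2⟩, hjx⟩
  · rw [mem_starAvoid]
    refine ⟨image_mem_stab (by omega) (Finset.card_range k) _ ?_ ?_, ?_, ?_⟩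
    · intro j hj
      have := mul_add_le_mul s (Finset.mem_range.1 hj)
      split_ifs <;> omega
    · intro i hi j hj hij
      left
      have h1 := mul_add_le_mul s (Finset.mem_range.1 hj)
      have h3 := mul_add_le_mul s hij
      have h6 : i = 0 → i * s = 0 := fun h => by simp [h]
      split_ifs <;> omega
    · exact Finset.mem_image.2 ⟨0, Finset.mem_range.2 (by omega), by simp⟩
    · simp only [Finset.mem_image, mem_tightTail]
      rintro _ ⟨i, -, rfl⟩ ⟨j, hj, hji⟩
      split_ifs at hji with h
      · have := mul_add_le_mul s (show 0 < j by omega)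
        omega
      · exact hP1 _ _ hji
  · intro U hU he
    obtain ⟨hUs, h0, hav⟩ := mem_starAvoid.1 hU
    obtain ⟨hlt, hcard, hsep⟩ := mem_stab.1 hUs
    have hV : ∀ j, 1 ≤ j → j < k → j * s + 1 ∈ U.image f := by
      intro j hj hjk
      rw [he]
      exact Finset.mem_image.2 ⟨j, Finset.mem_range.2 hjk, by rw [if_neg (by omega)]⟩
    have hV' : ∀ j, 1 ≤ j → j < k → (j * s + 1 ∈ U ∨ (P (j * s) ∧ j * s ∈ U)) := by
      intro j hj hjk
      obtain ⟨x, hx, hxj⟩ := Finset.mem_image.1 (hV j hj hjk)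
      by_cases h : P x
      · rw [hfP x h] at hxj
        obtain rfl : x = j * s := by omega
        exact Or.inr ⟨h, hx⟩
      · rw [hfN x h] at hxj
        exact Or.inl (hxj ▸ hx)
    have h1 : 1 * s + 1 ∈ U := by
      rcases hV' 1 le_rfl (by omega) with h | ⟨h, -⟩
      · exact h
      · have := hPks _ h
        omega
    have h2 : 2 * s ∈ U := by
      rcases hV' 2 (by omega) (by omega) with h | ⟨-, h⟩
      · exact absurd ((mem_shiftedTail hk).2 (Or.inr (Or.inr ⟨2, by omega, rfl⟩))) (hav _ h)
      · exact h
    have := hsep _ h1 _ h2 (by omega)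
    omega

open Classical in
/-- Pushing points towards `0` along a nonincreasing sequence of offsets. -/
theorem exists_push {n k s r J c₁ c₂ : ℕ} (hs : 2 ≤ s) (hk : 1 ≤ k) (hn : n = s * k + r)
    (hr : r < s) (hc : c₂ ≤ c₁) (hc₁ : c₁ < s) :
    ∃ (f : ℕ → ℕ) (D : Set ℕ), Set.InjOn f D ∧ ∀ U ∈ starAvoid n k s 0 (tightTail k s),
      (∀ x ∈ U, x ∈ D) ∧ U.image f ∈ stab n k s ∧ 0 ∈ U.image f ∧
      ∀ j, 1 ≤ j → j * s + (if j < J then c₁ else c₂) ∉ U.image f := by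
  have hks : s * k = k * s := mul_comm _ _
  set σ : ℕ → ℕ := fun j => if j < J then c₁ else c₂ with hσ
  have hσs : ∀ j, σ j < s := fun j => by simp only [hσ]; split_ifs <;> omega
  have hσm : ∀ j, σ (j + 1) ≤ σ j := fun j => by simp only [hσ]; split_ifs <;> omega
  -- The stretch just above `j * s`, up to offset `σ j`, slides down by one into the free point `j *
  -- s`. The hole thereby moves from `j * s` to `j * s + σ j`.
  set P : ℕ → Prop := fun x => ∃ j, 1 ≤ j ∧ j * s + 1 ≤ x ∧ x ≤ j * s + σ j with hP
  set f : ℕ → ℕ := fun x => if P x then x - 1 else x with hf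
  have hfP : ∀ x, P x → f x = x - 1 := fun x hx => if_pos hx
  have hfN : ∀ x, ¬ P x → f x = x := fun x hx => if_neg hx
  have hPs : ∀ x, P x → s + 1 ≤ x := by
    rintro x ⟨j, hj, hjx, -⟩
    have := mul_add_le_mul s (show 0 < j by omega)
    omega
  have hblock : ∀ j, j * s + s ≤ n → j < k := by
    intro j hj
    by_contra h
    have := Nat.mul_le_mul_right s (not_lt.1 h)
    omega
  refine ⟨f, {x | x + s ≤ n ∧ ∀ j, 1 ≤ j → x ≠ j * s}, ?_, ?_⟩
  · have key : ∀ x y, (y + s ≤ n ∧ ∀ j, 1 ≤ j → y ≠ j * s) → P x → ¬ P y → x - 1 ≠ y := by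
      rintro x y ⟨-, hy⟩ ⟨j, hj, h1, h2⟩ hPy rfl
      exact hPy ⟨j, hj, by have := hy j hj; omega, by omega⟩
    intro x hx y hy hxy
    by_cases h3 : P x <;> by_cases h4 : P y
    · rw [hfP x h3, hfP y h4] at hxy
      have := hPs x h3
      have := hPs y h4
      omega
    · rw [hfP x h3, hfN y h4] at hxy
      exact absurd hxy (key x y hy h3 h4)
    · rw [hfN x h3, hfP y h4] at hxy
      exact absurd hxy.symm (key y x hx h4 h3)
    · rwa [hfN x h3, hfN y h4] at hxy
  · intro U hU
    obtain ⟨hUs, h0, hav⟩ := mem_starAvoid.1 hU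
    obtain ⟨hlt, hcard, hsep⟩ := mem_stab.1 hUs
    have hsn : s ≤ n := by have := mul_add_le_mul s (show 0 < k by omega); omega
    have hle : ∀ x ∈ U, x + s ≤ n := by
      intro x hx
      by_cases h : x = 0
      · omega
      · exact (bounds_of_zero_mem hUs h0 hx h).2
    have hne : ∀ x ∈ U, ∀ j, 1 ≤ j → x ≠ j * s := by
      rintro x hx j hj rfl
      exact hav _ hx (mem_tightTail.2 ⟨j, ⟨hj, hblock j (hle _ hx)⟩, rfl⟩)
    refine ⟨fun x hx => ⟨hle x hx, hne x hx⟩, image_mem_stab (by omega) hcard f ?_ ?_, ?_, ?_⟩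
    · intro x hx
      have := hlt x hx
      by_cases h : P x
      · rw [hfP x h]; omega
      · rwa [hfN x h]
    · intro x hx y hy hxy
      left
      have h1 := hsep x hx y hy hxy
      -- Since `σ` is nonincreasing, the point `s` below a moved point in block `j ≥ 2` is moved as
      -- well. In the first block it would lie strictly between 0 and `s`, impossible as 0 is a
      -- member.
      have h2 : ¬ P x → P y → x + s ≠ y := by
        rintro hx' ⟨j, hj, hj1, hj2⟩ rfl
        have hσj := hσs j
        rcases Nat.lt_or_ge j 2 with h | h
        · obtain rfl : j = 1 := by omega
          have := bounds_of_zero_mem hUs h0 hx (by omega)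
          omega
        · obtain ⟨i, rfl⟩ : ∃ i, j = i + 1 := ⟨j - 1, by omega⟩
          have := hσm i
          rw [Nat.succ_mul] at hj1 hj2
          exact hx' ⟨i, by omega, by omega, by omega⟩
      have hy1 := hlt y hy
      by_cases h4 : P x <;> by_cases h5 : P y
      · have := hPs x h4
        rw [hfP x h4, hfP y h5]; omega
      · have := hPs x h4
        rw [hfP x h4, hfN y h5]; omega
      · have := h2 h4 h5
        rw [hfN x h4, hfP y h5]; omega
      · rw [hfN x h4, hfN y h5]; omega
    · refine Finset.mem_image.2 ⟨0, h0, hfN 0 fun h => ?_⟩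
      have := hPs 0 h
      omega
    · intro j hj hm
      change j * s + σ j ∈ _ at hm
      obtain ⟨x, hx, hxj⟩ := Finset.mem_image.1 hm
      have hσj := hσs j
      have hxne := hne x hx
      by_cases h : P x
      · rw [hfP x h] at hxj
        have := hPs x h
        obtain ⟨i, hi, hi1, hi2⟩ := h
        have hσi := hσs i
        rcases lt_trichotomy i j with h' | h' | h'
        · have := mul_add_le_mul s h'; omega
        · subst h'; omega
        · have := mul_add_le_mul s h'; omega
      · rw [hfN x h] at hxj
        have := hxne j hj
        exact h ⟨j, hj, by omega, by omega⟩

/-- Rotating by `w` takes 0 to `w`, so the rotated set avoids the tight set once the original avoids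
the points `t * s - w` modulo `n`. `exists_push` first moves the holes from the multiples of `s` to
these points. -/
theorem card_starAvoid_tightTail_le {n k s r w : ℕ} (hs : 2 ≤ s) (hk : 1 ≤ k)
    (hn : n = s * k + r) (hr : r < s) (hw : w < n) (hwt : w ∉ tight k s) :
    (starAvoid n k s 0 (tightTail k s)).card ≤ (starAvoid n k s w (tight k s)).card := by
  have hks : s * k = k * s := mul_comm _ _
  obtain ⟨a, i, hak, hi, hwi, hik⟩ :
      ∃ a i, a < k ∧ 0 < i ∧ w = a * s + i ∧ (i < s ∨ (a + 1 = k ∧ s ≤ i)) := by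
    have hdiv := Nat.div_add_mod w s
    rw [mul_comm] at hdiv
    have hmod := Nat.mod_lt w (show s > 0 by omega)
    by_cases h : w / s < k
    · refine ⟨w / s, w % s, h, ?_, hdiv.symm, Or.inl hmod⟩
      by_contra h0
      exact hwt (mem_tight.2 ⟨w / s, h, by omega⟩)
    · obtain ⟨m, rfl⟩ : ∃ m, k = m + 1 := ⟨k - 1, by omega⟩
      have h1 := Nat.mul_le_mul_right s (not_lt.1 h)
      rw [Nat.succ_mul] at h1
      exact ⟨m, w - m * s, by omega, by omega, by omega, Or.inr ⟨rfl, by omega⟩⟩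
  have main : ∀ J c₁ c₂, c₂ ≤ c₁ → c₁ < s →
      (∀ U ∈ stab n k s, 0 ∈ U →
        (∀ j, 1 ≤ j → j * s + (if j < J then c₁ else c₂) ∉ U) →
        ∀ x ∈ U, rot n w x ∉ tight k s) →
      (starAvoid n k s 0 (tightTail k s)).card ≤ (starAvoid n k s w (tight k s)).card := by
    intro J c₁ c₂ hc hc₁ hav
    obtain ⟨f, D, hfD, h⟩ := exists_push (J := J) hs hk hn hr hc hc₁
    have hrot : Set.InjOn (fun U : Finset ℕ => U.image (rot n w)) (stab n k s) :=
      image_injOn_of_injOn (rot_injOn) _ fun U hU => (mem_stab.1 hU).1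
    refine Finset.card_le_card_of_injOn (fun U => (U.image f).image (rot n w)) ?_ ?_
    · intro U hU
      obtain ⟨-, h1, h2, h3⟩ := h U hU
      refine mem_starAvoid.2 ⟨image_rot_mem_stab (by omega) hw.le h1, ?_, ?_⟩
      · exact Finset.mem_image.2 ⟨0, h2, by unfold rot; split_ifs <;> omega⟩
      · intro y hy
        obtain ⟨x, hx, rfl⟩ := Finset.mem_image.1 hy
        exact hav _ h1 h2 h3 x hx
    · intro U hU V hV hUV
      exact image_injOn_of_injOn hfD _ (fun U hU => (h U hU).1) hU hV
        (hrot (h U hU).2.1 (h V hV).2.1 hUV)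
  have hrotx : ∀ x, rot n w x = x + w ∨ rot n w x + n = x + w := by
    intro x; unfold rot; split_ifs <;> omega
  rcases hik with his | ⟨hak', his⟩
  · refine main (k - a) (s - i) (r - i) (by omega) (by omega) ?_
    intro U hU h0 hav x hx hxt
    obtain ⟨t, ht, htx⟩ := mem_tight.1 hxt
    have hxn := (mem_stab.1 hU).1 x hx
    rcases hrotx x with h | h
    · have hat : a < t := by
        by_contra hcon
        have := Nat.mul_le_mul_right s (not_lt.1 hcon)
        omega
      obtain ⟨j, rfl⟩ : ∃ j, t = a + j + 1 := ⟨t - a - 1, by omega⟩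
      have e : (a + j + 1) * s = a * s + j * s + s := by ring
      rcases Nat.eq_zero_or_pos j with hj | hj
      · subst hj
        have := bounds_of_zero_mem hU h0 hx (by omega)
        omega
      · refine hav j hj ?_
        rw [if_pos (by omega)]
        convert hx using 1
        omega
    · obtain ⟨b, rfl⟩ : ∃ b, k = a + b + 1 := ⟨k - a - 1, by omega⟩
      have e1 : (a + b + 1) * s = a * s + b * s + s := by ring
      have e2 : (t + b) * s = t * s + b * s := by ring
      have e3 : (t + b + 1) * s = t * s + b * s + s := by ring
      by_cases hri : i ≤ r
      · refine hav (t + b + 1) (by omega) ?_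
        rw [if_neg (by omega)]
        convert hx using 1
        omega
      · obtain ⟨c, hc1, hc2⟩ := exists_window (by omega) hk hn hU h0 hx
        rcases lt_trichotomy c (t + b) with h' | h' | h'
        · have := mul_add_le_mul s h'; omega
        · subst h'; omega
        · have := mul_add_le_mul s h'; omega
  · have hke : k * s = a * s + s := by rw [← hak', Nat.succ_mul]
    -- In the long last block, `t * s - w + n = t * s + (s + r - i)`, so one constant offset
    -- suffices.
    refine main 0 (s + r - i) (s + r - i) le_rfl (by omega) ?_
    intro U hU h0 hav x hx hxt
    obtain ⟨t, ht, htx⟩ := mem_tight.1 hxt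
    have hxn := (mem_stab.1 hU).1 x hx
    rcases hrotx x with h | h
    · have := mul_add_le_mul s ht
      omega
    · rcases Nat.eq_zero_or_pos t with hj | hj
      · subst hj
        have := bounds_of_zero_mem hU h0 hx (by omega)
        omega
      · refine hav t hj ?_
        rw [if_neg (by omega)]
        convert hx using 1
        omega

/-- `shiftedHead` differs from `shiftedTail` by a single point, which makes their neighbourhood
difference small. Its preimage under an automorphism taking the tight set to `shiftedTail` would
differ from the tight set in some point `w`, and the star at `w` is already too large. -/
theorem not_isVertexTransitive_of_lt {n k s : ℕ} (hs : 2 ≤ s) (hk : 3 ≤ k)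
    (hn : s * k + 2 ≤ n) (hns : n < s * k + s) :
    ¬ (stableKneserGraph n k s).IsVertexTransitive := by
  rw [isVertexTransitive_iff (by omega)]
  intro h
  have hS := tight_mem_stab (n := n) (k := k) (s := s) (by omega) (by omega)
  have hS' := shiftedTail_mem_stab hs hk hn
  have hT := shiftedHead_mem_stab hs hn
  obtain ⟨g, hg, hd⟩ := h ⟨_, hS⟩ ⟨_, hS'⟩
  have hlt := card_starAvoid_shiftedTail_lt hs hk hn hns
  set T := g.symm ⟨_, hT⟩ with hTdef
  have hcard := card_nbrDiff_map g hd ⟨_, hS⟩ T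
  rw [hg, hTdef, Equiv.apply_symm_apply, ← hTdef] at hcard
  have h1 : nbrDiff n k s (shiftedTail n k s) (shiftedHead k s) ⊆
      starAvoid n k s 0 (shiftedTail n k s) := by
    intro U hU
    obtain ⟨hUs, hUA, hUB⟩ := mem_nbrDiff.1 hU
    rw [Finset.disjoint_left] at hUA
    refine mem_starAvoid.2 ⟨hUs, ?_, fun x hx => hUA hx⟩
    obtain ⟨x, hx, hxT⟩ := Finset.not_disjoint_iff.1 hUB
    have hxS := hUA hx
    rw [mem_shiftedTail hk] at hxS
    rw [mem_shiftedHead hk] at hxT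
    rcases hxT with rfl | hxT | hxT
    · exact hx
    · exact absurd (Or.inl hxT) hxS
    · exact absurd (Or.inr (Or.inr hxT)) hxS
  have hne : T.1 ≠ tight k s := by
    intro he
    have h2 : T = ⟨_, hS⟩ := Subtype.ext he
    rw [hTdef, Equiv.symm_apply_eq, hg] at h2
    have h3 : shiftedHead k s = shiftedTail n k s := congrArg Subtype.val h2
    have h0 : 0 ∈ shiftedHead k s := (mem_shiftedHead hk).2 (Or.inl rfl)
    rw [h3, mem_shiftedTail hk] at h0
    rcases h0 with h0 | h0 | ⟨j, -, h0⟩ <;> omega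
  obtain ⟨w, hwT, hwS⟩ : ∃ w ∈ T.1, w ∉ tight k s := by
    by_contra! hcon
    refine hne (Finset.eq_of_subset_of_card_le hcon ?_)
    rw [(mem_stab.1 hS).2.1, (mem_stab.1 T.2).2.1]
  have h2 : starAvoid n k s w (tight k s) ⊆ nbrDiff n k s (tight k s) T.1 := by
    intro U hU
    obtain ⟨hUs, hwU, hav⟩ := mem_starAvoid.1 hU
    exact mem_nbrDiff.2 ⟨hUs, Finset.disjoint_left.2 hav, Finset.not_disjoint_iff.2 ⟨w, hwU, hwT⟩⟩
  obtain ⟨r, hr⟩ := Nat.exists_eq_add_of_le (show s * k ≤ n by omega)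
  have h3 := card_starAvoid_tightTail_le (w := w) hs (by omega) hr (by omega)
    ((mem_stab.1 T.2).1 w hwT) hwS
  have h4 := Finset.card_le_card h1
  have h5 := Finset.card_le_card h2
  dsimp only at hcard
  omega

/-! ### The case `k ≥ 3`, `n ≥ s * k + s`: degrees. -/

/-- The stable set obtained from the tight one by moving `0` to `n - 1`. -/
def tightMoved (n k s : ℕ) : Finset ℕ :=
  (Finset.range k).image fun j => if j = 0 then n - 1 else j * s

theorem mem_tightMoved {n k s x : ℕ} (hk : 1 ≤ k) : x ∈ tightMoved n k s ↔
    x = n - 1 ∨ x ∈ tightTail k s := by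
  simp only [tightMoved, mem_tightTail, Finset.mem_image, Finset.mem_range]
  constructor
  · rintro ⟨j, hj, rfl⟩
    split_ifs with h
    · exact Or.inl rfl
    · exact Or.inr ⟨j, by omega, rfl⟩
  · rintro (rfl | ⟨j, hj, rfl⟩)
    · exact ⟨0, by omega, by simp⟩
    · exact ⟨j, hj.2, by rw [if_neg (by omega)]⟩

theorem tightMoved_mem_stab {n k s : ℕ} (hs : 1 ≤ s) (hn : s * k + 1 ≤ n) :
    tightMoved n k s ∈ stab n k s := by
  have hks : s * k = k * s := mul_comm _ _
  refine image_mem_stab hs (Finset.card_range k) _ ?_ ?_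
  · intro j hj
    have := mul_add_le_mul s (Finset.mem_range.1 hj)
    split_ifs <;> omega
  · intro i hi j hj hij
    have h1 := mul_add_le_mul s (Finset.mem_range.1 hj)
    have h2 := mul_add_le_mul s hij
    split_ifs <;> omega

open Classical in
-- Rotating backwards by one takes 0 to `n - 1`, but would send `j * s + 1` to the forbidden `j *
-- s`. These points go one step further, to `j * s - 1`, which is free since `j * s` was avoided.
theorem card_starAvoid_tightTail_lt {n k s : ℕ} (hs : 2 ≤ s) (hk : 3 ≤ k)
    (hn : s * k + s ≤ n) :
    (starAvoid n k s 0 (tightTail k s)).card < (starAvoid n k s (n - 1) (tight k s)).card := by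
  have hks : s * k = k * s := mul_comm _ _
  set P : ℕ → Prop := fun x => ∃ j, (1 ≤ j ∧ j < k) ∧ j * s + 1 = x with hP
  set f : ℕ → ℕ := fun x => if x = 0 then n - 1 else if P x then x - 2 else x - 1 with hf
  have hf0 : f 0 = n - 1 := if_pos rfl
  have hPs : ∀ x, P x → s + 1 ≤ x := by
    rintro _ ⟨j, hj, rfl⟩
    have := mul_add_le_mul s hj.1
    omega
  have hfP : ∀ x, P x → f x = x - 2 := fun x hx => by
    have := hPs x hx
    simp only [hf]
    rw [if_neg (by omega), if_pos hx]
  have hfN : ∀ x, x ≠ 0 → ¬ P x → f x = x - 1 := fun x h0 hx => by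
    simp only [hf]
    rw [if_neg h0, if_neg hx]
  have hP1 : ∀ i j, i * s = j * s + 1 → False := by
    intro i j h
    rcases lt_trichotomy i j with h' | h' | h'
    · have := mul_add_le_mul s h'; omega
    · subst h'; omega
    · have := mul_add_le_mul s h'; omega
  -- The missed set is {2s - 1, 3s - 1, …, ks - 1, n - 1}; its last gap is where `n ≥ s * k + s` is
  -- needed. A preimage would contain ks, since ks + 1 is not among the doubly shifted points, and
  -- (k - 1)s + 1, since (k - 1)s is avoided; these are s - 1 apart.
  refine card_lt_card_of_image f {x | x < n ∧ x ∉ tightTail k s} ?_ ?_ ?_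
    (V := (Finset.range k).image fun j => if j = 0 then n - 1 else (j + 1) * s - 1) ?_ ?_
  · have key : ∀ x y, y ∉ tightTail k s → P x → ¬ P y → y ≠ 0 → x - 2 ≠ y - 1 := by
      rintro _ y hy ⟨j, hj, rfl⟩ - hy0 h
      have := mul_add_le_mul s hj.1
      exact hy (mem_tightTail.2 ⟨j, hj, by omega⟩)
    have hlt : ∀ x, x ≠ 0 → x < n → f x + 2 ≤ n := by
      intro x h0 hx
      by_cases h : P x
      · have := hPs x h
        rw [hfP x h]; omega
      · rw [hfN x h0 h]; omega
    rintro x ⟨hxn, hx⟩ y ⟨hyn, hy⟩ hxy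
    by_cases hx0 : x = 0
    · subst hx0
      by_contra hy0
      have := hlt y (Ne.symm hy0) hyn
      omega
    by_cases hy0 : y = 0
    · subst hy0
      have := hlt x hx0 hxn
      omega
    by_cases h3 : P x <;> by_cases h4 : P y
    · have := hPs x h3
      have := hPs y h4
      rw [hfP x h3, hfP y h4] at hxy
      omega
    · rw [hfP x h3, hfN y hy0 h4] at hxy
      exact absurd hxy (key x y hy h3 h4 hy0)
    · rw [hfN x hx0 h3, hfP y h4] at hxy
      exact absurd hxy.symm (key y x hx h4 h3 hx0)
    · rw [hfN x hx0 h3, hfN y hy0 h4] at hxy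
      omega
  · intro U hU x hx
    obtain ⟨hUs, h0, hav⟩ := mem_starAvoid.1 hU
    exact ⟨(mem_stab.1 hUs).1 x hx, hav x hx⟩
  · intro U hU
    obtain ⟨hUs, h0, hav⟩ := mem_starAvoid.1 hU
    obtain ⟨hlt, hcard, hsep⟩ := mem_stab.1 hUs
    have hb : ∀ x ∈ U, x ≠ 0 → s ≤ x ∧ x + s ≤ n := fun x hx => bounds_of_zero_mem hUs h0 hx
    rw [mem_starAvoid]
    refine ⟨image_mem_stab (by omega) hcard f ?_ ?_, ?_, ?_⟩
    · intro x hx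
      have := hlt x hx
      by_cases hx0 : x = 0
      · rw [hx0, hf0]; omega
      by_cases h : P x
      · rw [hfP x h]; omega
      · rw [hfN x hx0 h]; omega
    · intro x hx y hy hxy
      have h1 := hsep x hx y hy hxy
      have hy0 : y ≠ 0 := by omega
      have hyb := hb y hy hy0
      have hPy := hPs y
      by_cases hx0 : x = 0
      · right
        subst hx0
        by_cases h5 : P y
        · have := hPy h5
          rw [hf0, hfP y h5]; omega
        · rw [hf0, hfN y hy0 h5]; omega
      left
      have hxb := hb x hx hx0
      -- A point `s` below a doubly shifted point is doubly shifted too, or equals 1, which is too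
      -- close to the member 0.
      have h2 : ¬ P x → P y → x + s ≠ y := by
        rintro hx' ⟨j, hj, rfl⟩ h
        rcases Nat.lt_or_ge j 2 with h' | h'
        · obtain rfl : j = 1 := by omega
          omega
        · obtain ⟨i, rfl⟩ : ∃ i, j = i + 1 := ⟨j - 1, by omega⟩
          rw [Nat.succ_mul] at h
          exact hx' ⟨i, by omega, by omega⟩
      by_cases h4 : P x <;> by_cases h5 : P y
      · have := hPs x h4
        rw [hfP x h4, hfP y h5]; omega
      · have := hPs x h4
        rw [hfP x h4, hfN y hy0 h5]; omega
      · have := h2 h4 h5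
        rw [hfN x hx0 h4, hfP y h5]; omega
      · rw [hfN x hx0 h4, hfN y hy0 h5]; omega
    · exact Finset.mem_image.2 ⟨0, h0, hf0⟩
    · simp only [Finset.mem_image, mem_tight]
      rintro _ ⟨x, hx, rfl⟩ ⟨j, hj, hjx⟩
      have hjs := mul_add_le_mul s hj
      by_cases hx0 : x = 0
      · rw [hx0, hf0] at hjx
        omega
      have hxb := hb x hx hx0
      by_cases h : P x
      · rw [hfP x h] at hjx
        have := hPs x h
        obtain ⟨i, hi, rfl⟩ := h
        exact hP1 i j (by omega)
      · rw [hfN x hx0 h] at hjx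
        rcases Nat.eq_zero_or_pos j with h2 | h2
        · subst h2; omega
        · exact h ⟨j, ⟨h2, hj⟩, by omega⟩
  · have hj2 : ∀ j, j ≠ 0 → 2 * s ≤ (j + 1) * s := fun j hj => Nat.mul_le_mul_right s (by omega)
    rw [mem_starAvoid]
    refine ⟨image_mem_stab (by omega) (Finset.card_range k) _ ?_ ?_, ?_, ?_⟩
    · intro j hj
      have : (j + 1) * s ≤ k * s := Nat.mul_le_mul_right s (Finset.mem_range.1 hj)
      split_ifs <;> omega
    · intro i hi j hj hij
      have h1 : (j + 1) * s ≤ k * s := Nat.mul_le_mul_right s (Finset.mem_range.1 hj)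
      have h3 := mul_add_le_mul s (show i + 1 < j + 1 by omega)
      have := hj2 i
      have := hj2 j
      split_ifs <;> omega
    · exact Finset.mem_image.2 ⟨0, Finset.mem_range.2 (by omega), by simp⟩
    · simp only [Finset.mem_image, mem_tight]
      rintro _ ⟨i, -, rfl⟩ ⟨j, hj, hji⟩
      have hjs := mul_add_le_mul s hj
      have := hj2 i
      split_ifs at hji with h
      · omega
      · exact hP1 (i + 1) j (by omega)
  · intro U hU he
    obtain ⟨hUs, h0, hav⟩ := mem_starAvoid.1 hU
    obtain ⟨hlt, hcard, hsep⟩ := mem_stab.1 hUs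
    obtain ⟨m, rfl⟩ : ∃ m, k = m + 3 := ⟨k - 3, by omega⟩
    have e2 : (m + 2 + 1) * s = (m + 2) * s + s := by ring
    have e1 : (m + 1 + 1) * s = (m + 2) * s := by ring
    have hks' : (m + 3) * s = (m + 2) * s + s := by ring
    have hm2 : 2 * s ≤ (m + 2) * s := Nat.mul_le_mul_right s (by omega)
    have hV : ∀ j, j ≠ 0 → j < m + 3 → (j + 1) * s - 1 ∈ U.image f := by
      intro j hj hjk
      rw [he]
      exact Finset.mem_image.2 ⟨j, Finset.mem_range.2 hjk, by rw [if_neg hj]⟩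
    have hpre : ∀ j, j ≠ 0 → j < m + 3 →
        (j + 1) * s ∈ U ∨ (P ((j + 1) * s + 1) ∧ (j + 1) * s + 1 ∈ U) := by
      intro j hj hjk
      have hjs : (j + 1) * s ≤ (m + 3) * s := Nat.mul_le_mul_right s hjk
      have hj2 : 2 * s ≤ (j + 1) * s := Nat.mul_le_mul_right s (by omega)
      obtain ⟨x, hx, hxj⟩ := Finset.mem_image.1 (hV j hj hjk)
      by_cases hx0 : x = 0
      · rw [hx0, hf0] at hxj
        omega
      by_cases h : P x
      · have := hPs x h
        rw [hfP x h] at hxj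
        obtain rfl : x = (j + 1) * s + 1 := by omega
        exact Or.inr ⟨h, hx⟩
      · rw [hfN x hx0 h] at hxj
        obtain rfl : x = (j + 1) * s := by omega
        exact Or.inl hx
    have h1 : (m + 2 + 1) * s ∈ U := by
      rcases hpre (m + 2) (by omega) (by omega) with h | ⟨⟨i, hi, hi'⟩, -⟩
      · exact h
      · have := mul_add_le_mul s hi.2
        omega
    have h2 : (m + 1 + 1) * s + 1 ∈ U := by
      rcases hpre (m + 1) (by omega) (by omega) with h | ⟨-, h⟩
      · exact absurd (mem_tightTail.2 ⟨m + 1 + 1, by omega, rfl⟩) (hav _ h)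
      · exact h
    have := hsep _ h2 _ h1 (by omega)
    omega

/-- The common neighbours of the tight set and `tightMoved` cancel, so the difference of the two
degrees is the difference of the two `nbrDiff` counts. -/
theorem not_isVertexTransitive_of_le {n k s : ℕ} (hs : 2 ≤ s) (hk : 3 ≤ k)
    (hn : s * k + s ≤ n) : ¬ (stableKneserGraph n k s).IsVertexTransitive := by
  rw [isVertexTransitive_iff (by omega)]
  intro h
  have hS := tight_mem_stab (n := n) (k := k) (s := s) (by omega) (by omega)
  have hS' := tightMoved_mem_stab (n := n) (k := k) (s := s) (by omega) (by omega)
  obtain ⟨g, hg, hd⟩ := h ⟨_, hS⟩ ⟨_, hS'⟩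
  have hdeg := card_filter_stab_eq g (fun U => Disjoint U (tight k s))
    (fun U => Disjoint U (tightMoved n k s)) fun A => by
      rw [← hd A ⟨_, hS⟩, hg]
  have hlt := card_starAvoid_tightTail_lt hs hk hn
  have hsplit : ∀ A B : Finset ℕ, ((stab n k s).filter fun U => Disjoint U A).card =
      ((stab n k s).filter fun U => Disjoint U A ∧ Disjoint U B).card +
        (nbrDiff n k s A B).card := by
    intro A B
    rw [← Finset.card_filter_add_card_filter_not (fun U => Disjoint U B), Finset.filter_filter,
      Finset.filter_filter]
    rfl
  rw [hsplit _ (tightMoved n k s), hsplit (tightMoved n k s) (tight k s)] at hdeg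
  have hcomm : ((stab n k s).filter fun U => Disjoint U (tight k s) ∧
      Disjoint U (tightMoved n k s)) = (stab n k s).filter fun U =>
      Disjoint U (tightMoved n k s) ∧ Disjoint U (tight k s) := by
    simp only [and_comm]
  rw [hcomm] at hdeg
  have hks : s * k = k * s := mul_comm _ _
  have hlast : n - 1 ∈ tightMoved n k s := (mem_tightMoved (by omega)).2 (Or.inl rfl)
  have h1 : starAvoid n k s (n - 1) (tight k s) ⊆
      nbrDiff n k s (tight k s) (tightMoved n k s) := by
    intro U hU
    obtain ⟨hUs, hwU, hav⟩ := mem_starAvoid.1 hU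
    exact mem_nbrDiff.2 ⟨hUs, Finset.disjoint_left.2 hav,
      Finset.not_disjoint_iff.2 ⟨n - 1, hwU, hlast⟩⟩
  have h2 : nbrDiff n k s (tightMoved n k s) (tight k s) ⊆
      starAvoid n k s 0 (tightTail k s) := by
    intro U hU
    obtain ⟨hUs, hUA, hUB⟩ := mem_nbrDiff.1 hU
    rw [Finset.disjoint_left] at hUA
    have hav : ∀ x ∈ U, x ∉ tightTail k s := fun x hx hxt =>
      hUA hx ((mem_tightMoved (by omega)).2 (Or.inr hxt))
    refine mem_starAvoid.2 ⟨hUs, ?_, hav⟩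
    obtain ⟨x, hx, hxT⟩ := Finset.not_disjoint_iff.1 hUB
    obtain ⟨j, hj, rfl⟩ := mem_tight.1 hxT
    rcases Nat.eq_zero_or_pos j with h | h
    · simpa [h] using hx
    · exact absurd (mem_tightTail.2 ⟨j, ⟨h, hj⟩, rfl⟩) (hav _ hx)
  have h3 := Finset.card_le_card h1
  have h4 := Finset.card_le_card h2
  omega

/-! ### The case `k = 2`: edges of a circulant graph. -/

theorem pair_mem_stab {n s a b : ℕ} (hs : 1 ≤ s) : ({a, b} : Finset ℕ) ∈ stab n 2 s ↔
    a < n ∧ b < n ∧ ((a + s ≤ b ∧ b + s ≤ a + n) ∨ (b + s ≤ a ∧ a + s ≤ b + n)) := by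
  rw [mem_stab]
  constructor
  · rintro ⟨hlt, hcard, hsep⟩
    refine ⟨hlt a (by simp), hlt b (by simp), ?_⟩
    rcases lt_trichotomy a b with h | h | h
    · exact Or.inl (hsep a (by simp) b (by simp) h)
    · subst h
      simp at hcard
    · exact Or.inr (hsep b (by simp) a (by simp) h)
  · rintro ⟨ha, hb, h⟩
    refine ⟨by simp [ha, hb], Finset.card_pair (by omega), ?_⟩
    simp only [Finset.mem_insert, Finset.mem_singleton]
    rintro i (rfl | rfl) j (rfl | rfl) hij <;> omega

theorem eq_pair_of_mem_stab {n s a b : ℕ} {U : Finset ℕ} (hU : U ∈ stab n 2 s) (ha : a ∈ U)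
    (hb : b ∈ U) (hab : a ≠ b) : U = {a, b} := by
  symm
  refine Finset.eq_of_subset_of_card_le ?_ ?_
  · simp [Finset.insert_subset_iff, ha, hb]
  · rw [Finset.card_pair hab, (mem_stab.1 hU).2.1]

theorem exists_eq_pair_of_mem_stab {n s : ℕ} {U : Finset ℕ} (hU : U ∈ stab n 2 s) :
    ∃ a b, a < b ∧ U = {a, b} := by
  obtain ⟨a, b, hab, rfl⟩ := Finset.card_eq_two.1 (mem_stab.1 hU).2.1
  rcases lt_or_gt_of_ne hab with h | h
  · exact ⟨a, b, h, rfl⟩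
  · exact ⟨b, a, h, Finset.pair_comm a b⟩

theorem card_starAvoid_empty_le {n k s a b : ℕ} (hs : 1 ≤ s) (ha : a < n) (hb : b < n) :
    (starAvoid n k s a ∅).card ≤ (starAvoid n k s b ∅).card := by
  obtain ⟨w, hw, hwab⟩ : ∃ w ≤ n, rot n w a = b := by
    by_cases h : a ≤ b
    · exact ⟨b - a, by omega, by unfold rot; split_ifs <;> omega⟩
    · exact ⟨b + n - a, by omega, by unfold rot; split_ifs <;> omega⟩
  refine card_le_card_of_image (rot n w) {x | x < n} rot_injOn ?_ ?_
  · intro U hU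
    exact (mem_stab.1 (mem_starAvoid.1 hU).1).1
  · intro U hU
    obtain ⟨hUs, haU, -⟩ := mem_starAvoid.1 hU
    exact mem_starAvoid.2 ⟨image_rot_mem_stab hs hw hUs,
      Finset.mem_image.2 ⟨a, haU, hwab⟩, by simp⟩

/-- The number of stable sets through a point. -/
def starCard (n k s : ℕ) : ℕ := (starAvoid n k s 0 ∅).card

theorem card_starAvoid_empty {n k s a : ℕ} (hs : 1 ≤ s) (ha : a < n) :
    (starAvoid n k s a ∅).card = starCard n k s :=
  (card_starAvoid_empty_le hs ha (by omega)).antisymm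
    (card_starAvoid_empty_le hs (by omega) ha)

/-- Of the edges at `z`, those meeting `e` are exactly the edges joining `z` to a point of `e`; all
points have the same degree `starCard n 2 s`. -/
theorem card_starAvoid_add {n s z : ℕ} (hs : 1 ≤ s) {e : Finset ℕ} (hz : z < n) (hze : z ∉ e) :
    (starAvoid n 2 s z e).card + (e.filter fun p => {z, p} ∈ stab n 2 s).card =
      starCard n 2 s := by
  rw [← card_starAvoid_empty hs hz,
    ← Finset.card_filter_add_card_filter_not (s := starAvoid n 2 s z ∅) (fun U => Disjoint U e)]
  congr 1
  · congr 1
    ext U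
    simp [starAvoid, and_assoc]
  · rw [← Finset.card_image_of_injOn (f := fun p => ({z, p} : Finset ℕ))]
    · congr 1
      ext U
      simp only [Finset.mem_image, Finset.mem_filter, mem_starAvoid]
      constructor
      · rintro ⟨p, ⟨hpe, hp⟩, rfl⟩
        exact ⟨⟨hp, by simp, by simp⟩, Finset.not_disjoint_iff.2 ⟨p, by simp, hpe⟩⟩
      · rintro ⟨⟨hU, hzU, -⟩, hd⟩
        obtain ⟨p, hpU, hpe⟩ := Finset.not_disjoint_iff.1 hd
        have hzp : U = {z, p} := eq_pair_of_mem_stab hU hzU hpU fun h => hze (h ▸ hpe)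
        exact ⟨p, ⟨hpe, hzp ▸ hU⟩, hzp.symm⟩
    · intro p hp q hq hpq
      have hpe : p ∈ e := (Finset.mem_filter.1 hp).1
      have hm : p ∈ ({z, q} : Finset ℕ) := by
        have : ({z, p} : Finset ℕ) = {z, q} := hpq
        rw [← this]; simp
      simp only [Finset.mem_insert, Finset.mem_singleton] at hm
      rcases hm with rfl | h
      · exact absurd hpe hze
      · exact h

theorem nbrDiff_pair {n k s z w : ℕ} {e : Finset ℕ} :
    nbrDiff n k s e {z, w} = starAvoid n k s z e ∪ starAvoid n k s w e := by
  ext U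
  simp only [mem_nbrDiff, Finset.mem_union, mem_starAvoid, Finset.disjoint_left,
    Finset.mem_insert, Finset.mem_singleton]
  constructor
  · rintro ⟨hU, hd, h⟩
    by_cases hz : z ∈ U
    · exact Or.inl ⟨hU, hz, hd⟩
    · refine Or.inr ⟨hU, ?_, hd⟩
      by_contra hw
      refine h fun x hx => ?_
      rintro (rfl | rfl) <;> contradiction
  · rintro (⟨hU, hz, hd⟩ | ⟨hU, hz, hd⟩)
    · exact ⟨hU, hd, fun h => h hz (Or.inl rfl)⟩
    · exact ⟨hU, hd, fun h => h hz (Or.inr rfl)⟩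

/-- The edges forming a triangle with the edge `e`, seen through neighbourhoods. -/
def triangleEdges (n s : ℕ) (e : Finset ℕ) : Finset (Finset ℕ) :=
  {f ∈ stab n 2 s | f ≠ e ∧ ¬ Disjoint f e ∧ (nbrDiff n 2 s e f).card + 2 ≤ starCard n 2 s}

/-- For `f = {q, z}` with `q ∈ e` and `z ∉ e`, |N(e) \ N(f)| is the degree minus the number of ends
of `e` joined to `z`. The threshold 2 thus says that `z` completes a triangle on `e`. -/
theorem mem_triangleEdges {n s : ℕ} (hs : 1 ≤ s) {e f : Finset ℕ} (he : e ∈ stab n 2 s) :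
    f ∈ triangleEdges n s e ↔
      ∃ q ∈ e, ∃ z < n, z ∉ e ∧ (∀ p ∈ e, {z, p} ∈ stab n 2 s) ∧ f = {q, z} := by
  have key : ∀ q ∈ e, ∀ z < n, z ∉ e →
      ((nbrDiff n 2 s e {q, z}).card + 2 ≤ starCard n 2 s ↔ ∀ p ∈ e, {z, p} ∈ stab n 2 s) := by
    intro q hq z hz hze
    have h0 : starAvoid n 2 s q e = ∅ := by
      ext U
      simp only [mem_starAvoid, Finset.notMem_empty, iff_false]
      rintro ⟨-, h, h'⟩
      exact h' q h hq
    rw [nbrDiff_pair, h0, Finset.empty_union, ← card_starAvoid_add hs hz hze,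
      ← Finset.card_filter_eq_iff, (mem_stab.1 he).2.1]
    have := Finset.card_filter_le e fun p => {z, p} ∈ stab n 2 s
    rw [(mem_stab.1 he).2.1] at this
    omega
  simp only [triangleEdges, Finset.mem_filter]
  constructor
  · rintro ⟨hf, hfe, hd, hc⟩
    obtain ⟨q, hqf, hqe⟩ := Finset.not_disjoint_iff.1 hd
    obtain ⟨z, hzf, hze⟩ : ∃ z ∈ f, z ∉ e := by
      by_contra! hcon
      refine hfe (Finset.eq_of_subset_of_card_le hcon ?_)
      rw [(mem_stab.1 he).2.1, (mem_stab.1 hf).2.1]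
    have hqz : f = {q, z} := eq_pair_of_mem_stab hf hqf hzf fun h => hze (h ▸ hqe)
    have hz := (mem_stab.1 hf).1 z hzf
    rw [hqz] at hc
    exact ⟨q, hqe, z, hz, hze, (key q hqe z hz hze).1 hc, hqz⟩
  · rintro ⟨q, hqe, z, hz, hze, hp, rfl⟩
    refine ⟨Finset.pair_comm z q ▸ hp q hqe, ?_, ?_, (key q hqe z hz hze).2 hp⟩
    · rintro rfl
      simp at hze
    · exact Finset.not_disjoint_iff.2 ⟨q, by simp, hqe⟩

/-- The edges opposite to the edge `e` in a quadrangle, seen through neighbourhoods. -/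
def quadrangleEdges (n s : ℕ) (e : Finset ℕ) : Finset (Finset ℕ) :=
  {f ∈ stab n 2 s | Disjoint f e ∧ (nbrDiff n 2 s e f).card + 3 ≤ 2 * starCard n 2 s}

/-- The stars of `z` and `w` share only the edge {z, w}, so |N(e) \ N(f)| is twice the degree, minus
the number m of edges between `e` and `f`, minus 1. The threshold 3 thus says m ≥ 2. -/
theorem pair_mem_quadrangleEdges {n s x y z w : ℕ} (hs : 1 ≤ s) (hxy : x ≠ y) :
    {z, w} ∈ quadrangleEdges n s {x, y} ↔ {z, w} ∈ stab n 2 s ∧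
      (z ≠ x ∧ z ≠ y ∧ w ≠ x ∧ w ≠ y) ∧
      2 ≤ (if {z, x} ∈ stab n 2 s then 1 else 0) + (if {z, y} ∈ stab n 2 s then 1 else 0) +
        ((if {w, x} ∈ stab n 2 s then 1 else 0) +
          (if {w, y} ∈ stab n 2 s then 1 else 0)) := by
  simp only [quadrangleEdges, Finset.mem_filter]
  refine and_congr_right fun hf => ?_
  have hd : Disjoint ({z, w} : Finset ℕ) {x, y} ↔ (z ≠ x ∧ z ≠ y ∧ w ≠ x ∧ w ≠ y) := by
    simp [and_assoc]
    tauto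
  rw [hd]
  refine and_congr_right fun hne => ?_
  have hcount : ∀ v, (({x, y} : Finset ℕ).filter fun p => {v, p} ∈ stab n 2 s).card =
      (if {v, x} ∈ stab n 2 s then 1 else 0) + (if {v, y} ∈ stab n 2 s then 1 else 0) := by
    intro v
    rw [Finset.card_filter, Finset.sum_pair hxy]
  have hzw := (pair_mem_stab hs).1 hf
  have hz := card_starAvoid_add (e := {x, y}) hs hzw.1 (by simp [hne])
  have hw := card_starAvoid_add (e := {x, y}) hs hzw.2.1 (by simp [hne])
  rw [hcount] at hz hw
  have hU := Finset.card_union_add_card_inter (starAvoid n 2 s z {x, y})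
    (starAvoid n 2 s w {x, y})
  have hI : starAvoid n 2 s z {x, y} ∩ starAvoid n 2 s w {x, y} = {{z, w}} := by
    ext U
    simp only [Finset.mem_inter, mem_starAvoid, Finset.mem_singleton]
    constructor
    · rintro ⟨⟨hUs, hz, -⟩, -, hw, -⟩
      exact eq_pair_of_mem_stab hUs hz hw (by omega)
    · rintro rfl
      have := Finset.disjoint_left.1 (hd.2 hne)
      exact ⟨⟨hf, by simp, fun x hx => this hx⟩, hf, by simp, fun x hx => this hx⟩
  rw [hI, Finset.card_singleton, ← nbrDiff_pair] at hU
  omega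

theorem card_pairs_eq_of_isVertexTransitive {n s : ℕ} (hs : 1 ≤ s) (hn : s * 2 + 1 ≤ n)
    (h : (stableKneserGraph n 2 s).IsVertexTransitive) :
    (triangleEdges n s {0, s}).card = (triangleEdges n s {0, s + 1}).card ∧
      (quadrangleEdges n s {0, s}).card = (quadrangleEdges n s {0, s + 1}).card := by
  rw [isVertexTransitive_iff (by omega)] at h
  have hS : ({0, s} : Finset ℕ) ∈ stab n 2 s := (pair_mem_stab hs).2 (by omega)
  have hT : ({0, s + 1} : Finset ℕ) ∈ stab n 2 s := (pair_mem_stab hs).2 (by omega)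
  obtain ⟨g, hg, hd⟩ := h ⟨_, hS⟩ ⟨_, hT⟩
  have hd' : ∀ A, Disjoint (g A).1 {0, s + 1} ↔ Disjoint A.1 {0, s} := fun A => by
    rw [← hd A ⟨_, hS⟩, hg]
  have hc : ∀ A, (nbrDiff n 2 s {0, s + 1} (g A).1).card = (nbrDiff n 2 s {0, s} A.1).card :=
    fun A => by rw [← card_nbrDiff_map g hd ⟨_, hS⟩ A, hg]
  have he : ∀ A, (g A).1 = {0, s + 1} ↔ A.1 = {0, s} := fun A => by
    constructor
    · intro h
      have : g A = g ⟨_, hS⟩ := by rw [hg]; exact Subtype.ext h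
      exact congrArg Subtype.val (g.injective this)
    · intro h
      have : A = ⟨_, hS⟩ := Subtype.ext h
      rw [this, hg]
  constructor
  · exact card_filter_stab_eq g _ _ fun A => by rw [hd', hc, Ne, Ne, he]
  · exact card_filter_stab_eq g _ _ fun A => by rw [hd', hc]

/-- Move the point `s + 1` to `s`. -/
def pull (s x : ℕ) : ℕ := if x = s + 1 then s else x

theorem pull_injOn (s : ℕ) : Set.InjOn (pull s) {x | x ≠ s} := by
  intro x hx y hy h
  simp only [Set.mem_ofPred_eq] at hx hy
  unfold pull at h
  split_ifs at h <;> omega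

/-- The third vertex of a triangle runs over [2s + 1, n - s] for {0, s + 1} and over [2s, n - s] for
{0, s}. The gain is the vertex 2s, available because `3 * s ≤ n`. -/
theorem card_triangleEdges_lt {n s : ℕ} (hs : 2 ≤ s) (hn : 3 * s ≤ n) :
    (triangleEdges n s {0, s + 1}).card < (triangleEdges n s {0, s}).card := by
  have hS : ({0, s} : Finset ℕ) ∈ stab n 2 s := (pair_mem_stab (by omega)).2 (by omega)
  have hT : ({0, s + 1} : Finset ℕ) ∈ stab n 2 s := (pair_mem_stab (by omega)).2 (by omega)
  have hmem : ∀ f ∈ triangleEdges n s {0, s + 1}, ∃ q z, (q = 0 ∨ q = s + 1) ∧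
      2 * s + 1 ≤ z ∧ z + s ≤ n ∧ f = {q, z} := by
    intro f hf
    obtain ⟨q, hq, z, hz, -, hp, rfl⟩ := (mem_triangleEdges (by omega) hT).1 hf
    have h1 := (pair_mem_stab (by omega)).1 (hp 0 (by simp))
    have h2 := (pair_mem_stab (by omega)).1 (hp (s + 1) (by simp))
    exact ⟨q, z, by simpa using hq, by omega, by omega, rfl⟩
  refine card_lt_card_of_image (pull s) {x | x ≠ s} (pull_injOn s) ?_ ?_
    (V := {0, 2 * s}) ?_ ?_
  · intro f hf
    obtain ⟨q, z, hq, hz, hzn, rfl⟩ := hmem f hf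
    simp only [Finset.mem_insert, Finset.mem_singleton, Set.mem_ofPred_eq]
    omega
  · intro f hf
    obtain ⟨q, z, hq, hz, hzn, rfl⟩ := hmem f hf
    refine (mem_triangleEdges (by omega) hS).2 ⟨pull s q, ?_, z, by omega, ?_, ?_, ?_⟩
    · simp only [Finset.mem_insert, Finset.mem_singleton]
      unfold pull
      split_ifs <;> omega
    · simp only [Finset.mem_insert, Finset.mem_singleton]
      omega
    · simp only [Finset.mem_insert, Finset.mem_singleton]
      rintro p (rfl | rfl) <;> exact (pair_mem_stab (by omega)).2 (by omega)
    · rw [Finset.image_insert, Finset.image_singleton, show pull s z = z from if_neg (by omega)]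
  · refine (mem_triangleEdges (by omega) hS).2 ⟨0, by simp, 2 * s, by omega, ?_, ?_, rfl⟩
    · simp only [Finset.mem_insert, Finset.mem_singleton]
      omega
    · simp only [Finset.mem_insert, Finset.mem_singleton]
      rintro p (rfl | rfl) <;> exact (pair_mem_stab (by omega)).2 (by omega)
  · intro f hf he
    obtain ⟨q, z, hq, hz, hzn, rfl⟩ := hmem f hf
    have hm : 2 * s ∈ ({q, z} : Finset ℕ).image (pull s) := he ▸ by simp
    simp only [Finset.mem_image, Finset.mem_insert, Finset.mem_singleton] at hm
    obtain ⟨x, hx, hx'⟩ := hm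
    unfold pull at hx'
    split_ifs at hx' <;> omega

/-- As `n < 3 * s` there are no triangles, so two edges between disjoint edges form a quadrangle
with them. Pulling `s + 1` back to `s` keeps the smaller end joined to 0 and the larger one joined
to `s + 1`. The edge {1, n - s} is gained: it is disjoint from {0, s + 1} because `n ≥ 2 * s + 2`,
and pulled points never reach 1. -/
theorem card_quadrangleEdges_lt {n s : ℕ} (hs : 3 ≤ s) (hn : 2 * s + 2 ≤ n) (hns : n < 3 * s) :
    (quadrangleEdges n s {0, s}).card < (quadrangleEdges n s {0, s + 1}).card := by
  have hmem : ∀ f ∈ quadrangleEdges n s {0, s}, ∃ z w, s < z ∧ 2 * s < w ∧ z + s ≤ w ∧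
      z + s ≤ n ∧ w < n ∧ f = {z, w} := by
    intro f hf
    obtain ⟨z, w, hzw, rfl⟩ := exists_eq_pair_of_mem_stab (Finset.mem_filter.1 hf).1
    obtain ⟨h1, h2, h3⟩ := (pair_mem_quadrangleEdges (by omega) (by omega)).1 hf
    simp only [pair_mem_stab (show 1 ≤ s by omega)] at h1 h3
    refine ⟨z, w, ?_⟩
    split_ifs at h3 <;> simp only [and_true] <;> omega
  refine card_lt_card_of_image (pull s) {x | x ≠ s} (pull_injOn s) ?_ ?_
    (V := {1, n - s}) ?_ ?_
  · intro f hf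
    obtain ⟨z, w, h1, h2, h3, h4, h5, rfl⟩ := hmem f hf
    simp only [Finset.mem_insert, Finset.mem_singleton, Set.mem_ofPred_eq]
    omega
  · intro f hf
    obtain ⟨z, w, h1, h2, h3, h4, h5, rfl⟩ := hmem f hf
    rw [Finset.image_insert, Finset.image_singleton, show pull s w = w from if_neg (by omega)]
    refine (pair_mem_quadrangleEdges (by omega) (by omega)).2 ?_
    have hp : (z = s + 1 ∧ pull s z = s) ∨ (z ≠ s + 1 ∧ pull s z = z) := by
      unfold pull; split_ifs <;> omega
    generalize pull s z = v at hp
    rw [if_pos ((pair_mem_stab (by omega)).2 (by omega) : {v, 0} ∈ stab n 2 s),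
      if_pos ((pair_mem_stab (by omega)).2 (by omega) : {w, s + 1} ∈ stab n 2 s)]
    exact ⟨(pair_mem_stab (by omega)).2 (by omega), by omega, by omega⟩
  · refine (pair_mem_quadrangleEdges (by omega) (by omega)).2 ?_
    rw [if_pos ((pair_mem_stab (by omega)).2 (by omega) : {1, s + 1} ∈ stab n 2 s),
      if_pos ((pair_mem_stab (by omega)).2 (by omega) : {n - s, 0} ∈ stab n 2 s)]
    exact ⟨(pair_mem_stab (by omega)).2 (by omega), by omega, by omega⟩
  · intro f hf he
    obtain ⟨z, w, h1, h2, h3, h4, h5, rfl⟩ := hmem f hf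
    have hm : 1 ∈ ({z, w} : Finset ℕ).image (pull s) := he ▸ by simp
    simp only [Finset.mem_image, Finset.mem_insert, Finset.mem_singleton] at hm
    obtain ⟨x, hx, hx'⟩ := hm
    unfold pull at hx'
    split_ifs at hx' <;> omega

theorem not_isVertexTransitive_two {n s : ℕ} (hs : 2 ≤ s) (hn : s * 2 + 2 ≤ n) :
    ¬ (stableKneserGraph n 2 s).IsVertexTransitive := by
  intro h
  obtain ⟨h1, h2⟩ := card_pairs_eq_of_isVertexTransitive (by omega) (by omega) h
  rcases Nat.lt_or_ge n (3 * s) with h3 | h3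
  · exact (card_quadrangleEdges_lt (by omega) (by omega) h3).ne h2
  · exact (card_triangleEdges_lt hs h3).ne' h1

/-! ### The main theorem. -/

theorem theorem4p1 (n k s : ℕ) (hn : 2 ≤ n) (hk : 2 ≤ k) (hs : 2 ≤ s)
    (hnsk : s * k + 1 ≤ n) :
    (stableKneserGraph n k s).IsVertexTransitive ↔ n = s * k + 1 := by
  refine ⟨fun h => ?_, isVertexTransitive_of_eq (by omega) (by omega)⟩
  by_contra hne
  rcases Nat.lt_or_ge k 3 with h3 | h3
  · obtain rfl : k = 2 := by omega
    exact not_isVertexTransitive_two hs (by omega) h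
  · rcases Nat.lt_or_ge n (s * k + s) with h4 | h4
    · exact not_isVertexTransitive_of_lt hs h3 (by omega) h4 h
    · exact not_isVertexTransitive_of_le hs h3 h4 h
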